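/- **Conventions.** All matroids are finite. For a loopless matroid $M$ on the ground set $E$, let $\mathcal L(M)$ be its lattice of flats, $\operatorname{rk}$ its rank function, and $\mu(M)$ the value of the Möbius function of $\mathcal L(M)$ on the interval $[\varnothing,E]$. The *inverse Kazhdan–Lusztig polynomials* $Q_M(x)\in\mathbb Z[x]$ are the unique assignment of polynomials to loopless matroids $M$ such that 1. $Q_M(x)=1$ if $\operatorname{rk}(M)=0$; 2. $\deg Q_M(x)<\tfrac12\operatorname{rk}(M)$ if $\operatorname{rk}(M)>0$; 3. for every loopless $M$, the polynomial $$Y_M(x)=\sum_{F\in\mathcal L(M)}(-1)^{\operatorname{rk}(M)-\operatorname{rk}(F)}\,\mu(M/F)\,x^{\operatorname{rk}(M)-\operatorname{rk}(F)}\,Q_{M|_F}(x)$$ is palindromic, that is, $\deg Y_M\le \operatorname{rk}(M)$ and $x^{\operatorname{rk}(M)}\,Y_M(1/x)=Y_M(x)$. For a prime power $q$ and an integer $r\ge 2$, let $\operatorname{PG}(r-1,q)$ be the matroid of rank $r$ whose elements are the points of the projective space of $\mathbb F_q^{\,r}$ (its one-dimensional subspaces), a set of points being independent when the points are linearly independent.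 **Proposition** (single element deletion of projective geometries). Let $q$ be a prime power, let $r\ge 2$ be an integer, let $M=\operatorname{PG}(r-1,q)$, and let $i$ be any element of $M$. Then $$Q_{M\smallsetminus i}(x)=q^{\binom r2}-q^{\binom{r-1}2}+\left([r-1]_q\,q^{\binom{r-2}2}-q^{\binom{r-1}2}\right)x,$$ where $[r-1]_q=\dfrac{q^{r-1}-1}{q-1}$. -/

import Mathlib

open scoped Matroid Polynomial LinearAlgebra.Projectivization

namespace InvKL

universe u

variable {α : Type u}

/-- The rank `rk(M)` of a matroid of finite rank, as a natural number. -/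
noncomputable def rk (M : Matroid α) : ℕ := M.eRank.toNat

/-- The finite set of all flats of a matroid with finite ground set. -/
noncomputable def flats (M : Matroid α) [M.Finite] : Finset (Set α) :=
  (M.ground_finite.finite_subsets.subset
    (fun _ hF => Matroid.IsFlat.subset_ground hF) : {F | M.IsFlat F}.Finite).toFinset

theorem mem_flats (M : Matroid α) [M.Finite] {F : Set α} : F ∈ flats M ↔ M.IsFlat F := by
  simp [flats]

/-- The lattice of flats `L(M)`, as a type ordered by inclusion. -/
abbrev FlatLattice (M : Matroid α) : Type u := {F : Set α // M.IsFlat F}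

instance finite_flatLattice (M : Matroid α) [M.Finite] : Finite (FlatLattice M) :=
  (M.ground_finite.finite_subsets.subset
    (fun _ hF => Matroid.IsFlat.subset_ground hF) : {F | M.IsFlat F}.Finite).to_subtype

open scoped Classical in
noncomputable instance (M : Matroid α) [M.Finite] : LocallyFiniteOrder (FlatLattice M) :=
  letI : Fintype (FlatLattice M) := Fintype.ofFinite _
  Fintype.toLocallyFiniteOrder

open scoped Classical in
/-- The Möbius invariant `μ(M)`: the value of the Möbius function of the lattice of flats of `M`
on the interval from the least flat (which is `∅` when `M` is loopless) to the ground set. -/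
noncomputable def moebius (M : Matroid α) [M.Finite] : ℤ :=
  IncidenceAlgebra.mu ℤ (⟨M.closure ∅, M.isFlat_closure ∅⟩ : FlatLattice M)
    ⟨M.E, M.ground_isFlat⟩

/-- For an assignment `Q` of polynomials to matroids, the polynomial
`Y_M(x) = ∑_F (-1)^(rk M - rk F) μ(M / F) x^(rk M - rk F) Q_{M|F}(x)`, summed over the flats `F`
of `M`. -/
noncomputable def inverseZ (Q : Matroid α → ℤ[X]) (M : Matroid α) [M.Finite] : ℤ[X] :=
  ∑ F ∈ flats M,
    Polynomial.C ((-1) ^ (rk M - rk (M ↾ F)) * moebius (M ／ F)) *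
      Polynomial.X ^ (rk M - rk (M ↾ F)) * Q (M ↾ F)

/-- `p` is palindromic with respect to `d`: `deg p ≤ d` and `x^d p(1/x) = p(x)`. -/
def IsPalindromic (d : ℕ) (p : ℤ[X]) : Prop :=
  p.natDegree ≤ d ∧ p.reflect d = p

/-- The properties that characterize the inverse Kazhdan-Lusztig polynomials of the loopless
matroids (with finite ground set contained in the type `α`). -/
structure IsInverseKL (Q : Matroid α → ℤ[X]) : Prop where
  rank_zero : ∀ (M : Matroid α) [M.Finite] [M.Loopless], rk M = 0 → Q M = 1
  degree_lt : ∀ (M : Matroid α) [M.Finite] [M.Loopless], 0 < rk M → 2 * (Q M).natDegree < rk M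
  palindromic : ∀ (M : Matroid α) [M.Finite] [M.Loopless], IsPalindromic (rk M) (inverseZ Q M)

theorem ncard_restrict_lt (M : Matroid α) [M.Finite] {F : Set α}
    (hF : F ∈ (flats M).erase M.E) : (M ↾ F).E.ncard < M.E.ncard := by
  rw [Finset.mem_erase, mem_flats] at hF
  exact Set.ncard_lt_ncard (hF.2.subset_ground.ssubset_of_ne hF.1) M.ground_finite

theorem finite_of_mem_flats (M : Matroid α) [M.Finite] {F : Set α}
    (hF : F ∈ flats M) : (M ↾ F).Finite :=
  Matroid.restrict_finite (M.ground_finite.subset ((mem_flats M).1 hF).subset_ground)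

theorem loopless_of_mem_flats (M : Matroid α) [M.Finite] [M.Loopless] {F : Set α}
    (hF : F ∈ flats M) : (M ↾ F).Loopless :=
  Matroid.IsRestriction.loopless ⟨F, ((mem_flats M).1 hF).subset_ground, rfl⟩

theorem rk_restrict_le (M : Matroid α) [M.Finite] (F : Set α) : rk (M ↾ F) ≤ rk M :=
  ENat.toNat_le_toNat (M.eRk_le_eRank F) (by simp; infer_instance)

theorem moebius_contract_ground (M : Matroid α) [M.Finite] : moebius (M ／ M.E) = 1 := by
  have h : (⟨(M ／ M.E).closure ∅, (M ／ M.E).isFlat_closure ∅⟩ : FlatLattice (M ／ M.E)) =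
      ⟨(M ／ M.E).E, (M ／ M.E).ground_isFlat⟩ := by
    apply Subtype.ext
    have h1 : (M ／ M.E).E = ∅ := by simp
    have h2 := (M ／ M.E).closure_subset_ground ∅
    rw [h1] at h2
    exact (Set.subset_empty_iff.1 h2).trans h1.symm
  unfold moebius
  rw [h]
  exact IncidenceAlgebra.mu_self _

/-- The part of `inverseZ Q M` coming from the proper flats. -/
noncomputable def properPart (Q : Matroid α → ℤ[X]) (M : Matroid α) [M.Finite] : ℤ[X] := by
  classical
  exact ∑ F ∈ (flats M).erase M.E,
    Polynomial.C ((-1) ^ (rk M - rk (M ↾ F)) * moebius (M ／ F)) *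
      Polynomial.X ^ (rk M - rk (M ↾ F)) * Q (M ↾ F)

theorem inverseZ_eq (Q : Matroid α → ℤ[X]) (M : Matroid α) [M.Finite] :
    inverseZ Q M = Q M + properPart Q M := by
  classical
  unfold inverseZ properPart
  rw [← Finset.add_sum_erase (flats M) _ ((mem_flats M).2 M.ground_isFlat)]
  simp [moebius_contract_ground, Matroid.restrict_ground_eq_self]

theorem properPart_congr {Q Q' : Matroid α → ℤ[X]} (M : Matroid α) [M.Finite]
    (h : ∀ F ∈ flats M, F ≠ M.E → Q (M ↾ F) = Q' (M ↾ F)) :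
    properPart Q M = properPart Q' M := by
  classical
  unfold properPart
  refine Finset.sum_congr rfl fun F hF => ?_
  rw [Finset.mem_erase] at hF
  rw [h F hF.2 hF.1]

/-- A recursive construction, used to show that the characterizing properties can be satisfied. -/
noncomputable def recQ (M : Matroid α) : ℤ[X] := by
  classical
  exact
    if h : M.Finite then
      if rk M = 0 then 1
      else
        let R : ℤ[X] := ∑ F ∈ ((flats M).erase M.E).attach,
          Polynomial.C ((-1) ^ (rk M - rk (M ↾ F.1)) * moebius (M ／ F.1)) *
            Polynomial.X ^ (rk M - rk (M ↾ F.1)) * recQ (M ↾ F.1)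
        ∑ j ∈ (Finset.range (rk M)).filter (fun j => 2 * j < rk M),
          Polynomial.monomial j (R.coeff (rk M - j) - R.coeff j)
    else 1
termination_by M.E.ncard
decreasing_by exact ncard_restrict_lt M F.2

theorem recQ_zero (M : Matroid α) (h : rk M = 0) : recQ M = 1 := by
  rw [recQ]; simp [h]

theorem recQ_pos (M : Matroid α) [M.Finite] (h : rk M ≠ 0) :
    recQ M = ∑ j ∈ (Finset.range (rk M)).filter (fun j => 2 * j < rk M),
      Polynomial.monomial j
        ((properPart recQ M).coeff (rk M - j) - (properPart recQ M).coeff j) := by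
  classical
  have hfin : M.Finite := inferInstance
  rw [recQ]
  simp only [hfin, h, dite_true, if_false]
  have : ∑ F ∈ ((flats M).erase M.E).attach,
          Polynomial.C ((-1) ^ (rk M - rk (M ↾ F.1)) * moebius (M ／ F.1)) *
            Polynomial.X ^ (rk M - rk (M ↾ F.1)) * recQ (M ↾ F.1) = properPart recQ M := by
    unfold properPart
    exact Finset.sum_attach ((flats M).erase M.E) (fun F =>
      Polynomial.C ((-1) ^ (rk M - rk (M ↾ F)) * moebius (M ／ F)) *
            Polynomial.X ^ (rk M - rk (M ↾ F)) * recQ (M ↾ F))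
  rw [this]

theorem recQ_coeff (M : Matroid α) [M.Finite] (h : rk M ≠ 0) (k : ℕ) :
    (recQ M).coeff k = if 2 * k < rk M then
      (properPart recQ M).coeff (rk M - k) - (properPart recQ M).coeff k else 0 := by
  rw [recQ_pos M h, Polynomial.finsetSum_coeff]
  simp only [Polynomial.coeff_monomial]
  rw [Finset.sum_ite_eq']
  simp only [Finset.mem_filter, Finset.mem_range]
  congr 1
  apply propext
  omega

theorem recQ_degree (M : Matroid α) [M.Finite] (h : 0 < rk M) :
    2 * (recQ M).natDegree < rk M := by
  by_contra hc
  have h0 : (recQ M).coeff (recQ M).natDegree = 0 := by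
    rw [recQ_coeff M h.ne', if_neg hc]
  rw [Polynomial.coeff_natDegree, Polynomial.leadingCoeff_eq_zero] at h0
  rw [h0] at hc
  simp at hc
  omega

theorem recQ_degree_le (M : Matroid α) [M.Finite] : (recQ M).natDegree ≤ rk M := by
  rcases Nat.eq_zero_or_pos (rk M) with h | h
  · simp [recQ_zero M h]
  · have := recQ_degree M h
    omega

theorem properPart_degree (M : Matroid α) [M.Finite] :
    (properPart recQ M).natDegree ≤ rk M := by
  classical
  unfold properPart
  refine Polynomial.natDegree_sum_le_of_forall_le _ _ fun F hF => ?_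
  have := finite_of_mem_flats M (Finset.mem_of_mem_erase hF)
  have h1 := recQ_degree_le (M ↾ F)
  have h2 := rk_restrict_le M F
  refine Polynomial.natDegree_mul_le.trans ?_
  have h3 := Polynomial.natDegree_C_mul_X_pow_le
    ((-1) ^ (rk M - rk (M ↾ F)) * moebius (M ／ F)) (rk M - rk (M ↾ F))
  omega

theorem isPalindromic_iff (d : ℕ) (p : ℤ[X]) : IsPalindromic d p ↔
    p.natDegree ≤ d ∧ ∀ k ≤ d, p.coeff (d - k) = p.coeff k := by
  refine and_congr_right fun hd => ?_
  rw [Polynomial.ext_iff]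
  refine ⟨fun h k hk => ?_, fun h k => ?_⟩
  · have := h k
    rwa [Polynomial.coeff_reflect, Polynomial.revAt_le hk] at this
  · rw [Polynomial.coeff_reflect]
    rcases le_or_gt k d with hk | hk
    · rw [Polynomial.revAt_le hk, h k hk]
    · rw [Polynomial.revAt_eq_self_of_lt hk]

theorem properPart_rank_zero (Q : Matroid α → ℤ[X]) (M : Matroid α) [M.Finite] [M.Loopless]
    (h : rk M = 0) : properPart Q M = 0 := by
  classical
  have hE : M.E = ∅ := by
    by_contra hne
    obtain ⟨e, he⟩ := Set.nonempty_iff_ne_empty.2 hne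
    have h1 : M.Indep {e} := (Matroid.isNonloop_of_loopless he).indep
    have h2 := h1.encard_le_eRank
    have h3 : M.eRank ≠ ⊤ := by simp; infer_instance
    have h4 : M.eRank = 0 := by
      rcases (ENat.toNat_eq_zero).1 h with h | h
      · exact h
      · exact absurd h h3
    simp [h4] at h2
  unfold properPart
  apply Finset.sum_eq_zero
  intro F hF
  rw [Finset.mem_erase, mem_flats] at hF
  exact absurd (Set.subset_empty_iff.1 (hE ▸ hF.2.subset_ground)) (hE ▸ hF.1)

/-- The characterizing properties can be satisfied. -/
theorem exists_isInverseKL (α : Type u) : ∃ Q : Matroid α → ℤ[X], IsInverseKL Q := by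
  refine ⟨recQ, fun M _ _ h => recQ_zero M h, fun M _ _ h => recQ_degree M h, fun M _ _ => ?_⟩
  rw [isPalindromic_iff, inverseZ_eq]
  rcases Nat.eq_zero_or_pos (rk M) with h | h
  · rw [properPart_rank_zero _ M h, recQ_zero M h, h]
    simp
  · refine ⟨(Polynomial.natDegree_add_le _ _).trans
      (max_le (recQ_degree_le M) (properPart_degree M)), fun k hk => ?_⟩
    rw [Polynomial.coeff_add, Polynomial.coeff_add, recQ_coeff M h.ne', recQ_coeff M h.ne',
      Nat.sub_sub_self hk]
    rcases lt_trichotomy (2 * k) (rk M) with h1 | h1 | h1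
    · rw [if_neg (by omega), if_pos h1]; ring
    · rw [if_neg (by omega), if_neg (by omega), show rk M - k = k by omega]
    · rw [if_pos (by omega), if_neg (by omega)]; ring

/-- The characterizing properties determine the polynomials of all loopless finite matroids. -/
theorem isInverseKL_unique {Q Q' : Matroid α → ℤ[X]} (hQ : IsInverseKL Q)
    (hQ' : IsInverseKL Q') (M : Matroid α) [M.Finite] [M.Loopless] : Q M = Q' M := by
  induction hn : M.E.ncard using Nat.strong_induction_on generalizing M with
  | _ n ih =>
    classical
    rcases Nat.eq_zero_or_pos (rk M) with h | h
    · rw [hQ.rank_zero M h, hQ'.rank_zero M h]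
    · have hp : properPart Q M = properPart Q' M := by
        refine properPart_congr M fun F hF hne => ?_
        have := finite_of_mem_flats M hF
        have := loopless_of_mem_flats M hF
        exact ih _ (hn ▸ ncard_restrict_lt M (Finset.mem_erase.2 ⟨hne, hF⟩)) (M ↾ F) rfl
      have d1 := hQ.degree_lt M h
      have d2 := hQ'.degree_lt M h
      have p1 := ((isPalindromic_iff _ _).1 (hQ.palindromic M)).2
      have p2 := ((isPalindromic_iff _ _).1 (hQ'.palindromic M)).2
      rw [inverseZ_eq] at p1 p2
      ext k
      rcases lt_or_ge (2 * k) (rk M) with hk | hk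
      · have e1 := p1 k (by omega)
        have e2 := p2 k (by omega)
        simp only [Polynomial.coeff_add] at e1 e2
        rw [Polynomial.coeff_eq_zero_of_natDegree_lt (p := Q M) (n := rk M - k) (by omega)] at e1
        rw [Polynomial.coeff_eq_zero_of_natDegree_lt (p := Q' M) (n := rk M - k) (by omega)] at e2
        rw [hp] at e1
        linarith
      · rw [Polynomial.coeff_eq_zero_of_natDegree_lt (by omega),
          Polynomial.coeff_eq_zero_of_natDegree_lt (by omega)]

/-- The inverse Kazhdan-Lusztig polynomial `Q_M(x)` of a loopless matroid `M` with finite ground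
set. -/
noncomputable def inverseKL (M : Matroid α) : ℤ[X] :=
  Classical.choose (exists_isInverseKL α) M

/-- The projective geometry `PG(r - 1, q)` of rank `r` over the finite field `K` with `q` elements:
its elements are the points of the projective space of `K ^ r`, and a set of points is independent
when the points are linearly independent. -/
noncomputable def PG (K : Type u) [Field K] [Finite K] (r : ℕ) : Matroid (ℙ K (Fin r → K)) :=
  (IndepMatroid.ofFinite (E := Set.univ)
    (haveI : Finite (ℙ K (Fin r → K)) := Quotient.finite _
     Set.finite_univ)
    (fun I => Projectivization.Independent (fun p : I => (p : ℙ K (Fin r → K))))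
    (by
      rw [Projectivization.independent_iff]
      exact linearIndependent_empty_type)
    (by
      intro I J hJ hIJ
      rw [Projectivization.independent_iff] at hJ ⊢
      exact hJ.comp (Set.inclusion hIJ) (Set.inclusion_injective hIJ))
    (by
      classical
      have : Finite (ℙ K (Fin r → K)) := Quotient.finite _
      intro I J hI hJ hlt
      rw [Projectivization.independent_iff] at hI hJ
      change LinearIndepOn K Projectivization.rep I at hI
      change LinearIndepOn K Projectivization.rep J at hJ
      by_contra hcon
      push Not at hcon
      have hsub : Projectivization.rep '' J ⊆
          (Submodule.span K (Projectivization.rep '' I) : Set (Fin r → K)) := by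
        rintro _ ⟨e, he, rfl⟩
        by_cases heI : e ∈ I
        · exact Submodule.subset_span ⟨e, heI, rfl⟩
        · by_contra hns
          apply hcon e he heI
          rw [Projectivization.independent_iff]
          exact hI.insert hns
      have h1 := Submodule.finrank_mono (Submodule.span_le.2 hsub)
      have e1 : ∀ S : Set (ℙ K (Fin r → K)), LinearIndepOn K Projectivization.rep S →
          Module.finrank K (Submodule.span K (Projectivization.rep '' S)) = S.ncard := by
        intro S hS
        have := Fintype.ofFinite S
        rw [Set.image_eq_range, finrank_span_eq_card hS, Set.ncard_eq_toFinset_card',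
          Set.toFinset_card]
      rw [e1 I hI, e1 J hJ] at h1
      omega)
    (fun _ _ => Set.subset_univ _)).matroid

/-- The `q`-analogue `[n]_q = (q ^ n - 1) / (q - 1)`; the division is exact. -/
def qNumber (n q : ℕ) : ℤ := ((q : ℤ) ^ n - 1) / ((q : ℤ) - 1)

theorem qNumber_mul (n q : ℕ) : qNumber n q * ((q : ℤ) - 1) = (q : ℤ) ^ n - 1 :=
  Int.ediv_mul_cancel (sub_one_dvd_pow_sub_one _ _)

end InvKL

namespace InvKL

universe u v

/-! ### Möbius invariants of contractions -/

/-! A candidate for `Q_M` can be checked rather than computed: once `Q` is known on the proper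
flats, at most one polynomial of degree below half the rank makes `Y_M` palindromic
(`inverseKL_eq_of_isPalindromic`). Flats of a restriction of `PG` correspond to the subspaces
spanned by the retained points, so `Y_M` becomes a sum over subspaces (`inverseKL_PG_restrict_eq`),
evaluated by Gaussian binomials.

For the full geometry of rank `n`, the candidate `q ^ C(n,2)` turns `Y` into `P_n = subspacePoly q
n`, which is palindromic under `k ↔ n - k`.

Deleting a point `i` with line `L` removes exactly `L` from the lattice of subspaces. The only
Möbius value that changes is the one at `⊥`, which gains `μ(L, W)`. If the deletion formula is
extended to rank one, where it reads `-X`, this gain contributes to `Y` precisely the missing term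
at `L`. Hence `Y` is a sum over all subspaces, with the deletion polynomial on those through `i` and
`q ^ C(d,2)` on the others. Subtracting `P_n` leaves a sum over the subspaces through `i`, that is,
over the quotient by `L`. By `deletionPoly_sub` and the absorption identity it equals `[n-1] X
P_{n-2} - (1 + X) P_{n-1}`, and both terms are palindromic for `n`. -/

theorem mu_eq_mu_of_orderEmbedding {A : Type u} {B : Type v} [PartialOrder A] [PartialOrder B]
    [LocallyFiniteOrder A] [LocallyFiniteOrder B] [DecidableEq A] [DecidableEq B]
    (e : A ↪o B) (a : A) (he : ∀ y, e a ≤ y → ∃ x, e x = y) (b : A) :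
    IncidenceAlgebra.mu ℤ a b = IncidenceAlgebra.mu ℤ (e a) (e b) := by
  induction hn : (Finset.Ico a b).card using Nat.strong_induction_on generalizing b with
  | _ n ih =>
    rw [IncidenceAlgebra.mu_apply, IncidenceAlgebra.mu_apply]
    simp only [e.injective.eq_iff]
    congr 2
    refine Finset.sum_nbij e ?_ e.injective.injOn ?_ ?_
    · intro x hx
      simpa using hx
    · intro y hy
      rw [Finset.coe_Ico, Set.mem_Ico] at hy
      obtain ⟨x, rfl⟩ := he y hy.1
      exact ⟨x, by simpa using hy, rfl⟩
    · intro x hx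
      refine ih _ ?_ x rfl
      rw [← hn]
      refine Finset.card_lt_card ⟨Finset.Ico_subset_Ico_right (Finset.mem_Ico.1 hx).2.le, ?_⟩
      intro hsub
      exact absurd (Finset.mem_Ico.1 (hsub hx)).2 (lt_irrefl x)

variable {α : Type u}

theorem isFlat_union_of_isFlat_contract {M : Matroid α} {F X : Set α} (hF : M.IsFlat F)
    (hX : (M ／ F).IsFlat X) : M.IsFlat (X ∪ F) := by
  rw [Matroid.isFlat_iff_closure_eq] at hX ⊢
  rw [Matroid.contract_closure_eq] at hX
  have h1 : F ⊆ M.closure (X ∪ F) := by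
    conv_lhs => rw [← hF.closure]
    exact M.closure_subset_closure Set.subset_union_right
  nth_rw 2 [← hX]
  rw [Set.sdiff_union_of_subset h1]

theorem isFlat_contract_sdiff {M : Matroid α} {F G : Set α} (hG : M.IsFlat G) (hFG : F ⊆ G) :
    (M ／ F).IsFlat (G \ F) := by
  rw [Matroid.isFlat_iff_closure_eq, Matroid.contract_closure_eq, Set.sdiff_union_of_subset hFG,
    hG.closure]

theorem disjoint_of_isFlat_contract {M : Matroid α} {F X : Set α}
    (hX : (M ／ F).IsFlat X) : Disjoint X F :=
  (Set.subset_sdiff.1 hX.subset_ground).2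

/-- The flats of `M ／ F` are embedded into the flats of `M` by adding the flat `F`. -/
def contractFlatEmbedding (M : Matroid α) {F : Set α} (hF : M.IsFlat F) :
    FlatLattice (M ／ F) ↪o FlatLattice M where
  toFun X := ⟨X.1 ∪ F, isFlat_union_of_isFlat_contract hF X.2⟩
  inj' := by
    intro X Y h
    have h' : X.1 ∪ F = Y.1 ∪ F := congrArg Subtype.val h
    apply Subtype.ext
    rw [← (disjoint_of_isFlat_contract X.2).sup_sdiff_cancel_right,
      ← (disjoint_of_isFlat_contract Y.2).sup_sdiff_cancel_right]
    exact congrArg (· \ F) h'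
  map_rel_iff' := by
    intro X Y
    change X.1 ∪ F ⊆ Y.1 ∪ F ↔ X.1 ⊆ Y.1
    refine ⟨fun h x hx => ?_, fun h => Set.union_subset_union_left F h⟩
    rcases h (Or.inl hx) with h | h
    · exact h
    · exact absurd h (Set.disjoint_left.1 (disjoint_of_isFlat_contract X.2) hx)

open scoped Classical in
-- The flats of `M ／ F` form the upper interval of flats of `M` above `F`, so all contractions can
-- be treated inside one lattice.
theorem moebius_contract (M : Matroid α) [M.Finite] {F : Set α} (hF : M.IsFlat F) :
    moebius (M ／ F) =
      IncidenceAlgebra.mu ℤ (⟨F, hF⟩ : FlatLattice M) ⟨M.E, M.ground_isFlat⟩ := by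
  have hbot : (M ／ F).closure ∅ = ∅ := by
    rw [Matroid.contract_closure_eq, Set.empty_union, hF.closure, sdiff_self]
    rfl
  unfold moebius
  rw [mu_eq_mu_of_orderEmbedding (contractFlatEmbedding M hF)]
  · have h1 : contractFlatEmbedding M hF ⟨(M ／ F).closure ∅, (M ／ F).isFlat_closure ∅⟩ =
        ⟨F, hF⟩ := Subtype.ext (by
        change (M ／ F).closure ∅ ∪ F = F
        rw [hbot, Set.empty_union])
    have h2 : contractFlatEmbedding M hF ⟨(M ／ F).E, (M ／ F).ground_isFlat⟩ =
        ⟨M.E, M.ground_isFlat⟩ :=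
      Subtype.ext (Set.sdiff_union_of_subset hF.subset_ground)
    rw [h1, h2]
  · rintro ⟨G, hG⟩ h
    have hFG : F ⊆ G := Set.subset_union_right.trans h
    exact ⟨⟨G \ F, isFlat_contract_sdiff hG hFG⟩,
      Subtype.ext (Set.sdiff_union_of_subset hFG)⟩

open scoped Classical in
/-- The Möbius invariants of the contractions of `M` by flats are determined by their defining
recursion. -/
theorem moebius_contract_eq_of_sum_eq_zero (M : Matroid α) [M.Finite] (g : Set α → ℤ)
    (hE : g M.E = 1)
    (hg : ∀ F, M.IsFlat F → F ≠ M.E → ∑ G ∈ flats M with F ⊆ G, g G = 0)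
    {F : Set α} (hF : M.IsFlat F) : moebius (M ／ F) = g F := by
  induction hn : (M.E \ F).ncard using Nat.strong_induction_on generalizing F with
  | _ n ih =>
    by_cases hFE : F = M.E
    · rw [hFE, moebius_contract_ground, hE]
    -- This recursion varies the lower endpoint, so its terms are the invariants of contractions by
    -- larger flats, which the induction covers.
    rw [moebius_contract M hF, IncidenceAlgebra.mu_eq_neg_sum_Ioc_of_ne]
    swap
    · exact fun h => hFE (congrArg Subtype.val h)
    have h1 := hg F hF hFE
    rw [← Finset.add_sum_erase _ _ (a := F) (by simp [mem_flats, hF])] at h1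
    rw [← eq_neg_iff_add_eq_zero] at h1
    rw [h1]
    congr 1
    refine Finset.sum_bij (fun G _ => G.1) ?_ (fun _ _ _ _ h => Subtype.ext h) ?_ ?_
    · rintro ⟨G, hG⟩ h
      rw [Finset.mem_Ioc] at h
      simp only [Finset.mem_erase, Finset.mem_filter, mem_flats]
      exact ⟨fun h' => h.1.ne (Subtype.ext h'.symm), hG, h.1.le⟩
    · intro G h
      simp only [Finset.mem_erase, Finset.mem_filter, mem_flats] at h
      refine ⟨⟨G, h.2.1⟩, ?_, rfl⟩
      rw [Finset.mem_Ioc]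
      refine ⟨lt_of_le_of_ne h.2.2 fun h' => h.1 (congrArg Subtype.val h').symm, ?_⟩
      exact h.2.1.subset_ground
    · rintro ⟨G, hG⟩ h
      rw [Finset.mem_Ioc] at h
      rw [← moebius_contract M hG]
      refine ih _ ?_ hG rfl
      rw [← hn]
      have hlt : F ⊂ G := h.1
      refine Set.ncard_lt_ncard ?_ (M.ground_finite.subset Set.sdiff_subset)
      obtain ⟨x, hxG, hxF⟩ := Set.exists_of_ssubset hlt
      refine ⟨Set.sdiff_subset_sdiff_right hlt.subset, fun h' => ?_⟩
      exact (h' ⟨hG.subset_ground hxG, hxF⟩).2 hxG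

/-! ### Recognizing inverse Kazhdan-Lusztig polynomials -/

theorem inverseKL_isInverseKL : IsInverseKL (inverseKL : Matroid α → ℤ[X]) :=
  Classical.choose_spec (exists_isInverseKL α)

/-- Two solutions share the contribution of the proper flats, so their difference is palindromic for
`rk M`; having degree below `rk M / 2`, it vanishes. -/
theorem inverseKL_eq_of_isPalindromic (M : Matroid α) [M.Finite] [M.Loopless] (hM : 0 < rk M)
    (h : Set α → ℤ[X]) (hproper : ∀ F, M.IsFlat F → F ≠ M.E → inverseKL (M ↾ F) = h F)
    (hdeg : 2 * (h M.E).natDegree < rk M)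
    (hpal : IsPalindromic (rk M) (∑ F ∈ flats M,
      Polynomial.C ((-1) ^ (rk M - rk (M ↾ F)) * moebius (M ／ F)) *
        Polynomial.X ^ (rk M - rk (M ↾ F)) * h F)) :
    inverseKL M = h M.E := by
  classical
  have hsplit : ∑ F ∈ flats M, Polynomial.C ((-1) ^ (rk M - rk (M ↾ F)) * moebius (M ／ F)) *
      Polynomial.X ^ (rk M - rk (M ↾ F)) * h F = h M.E + properPart inverseKL M := by
    unfold properPart
    rw [← Finset.add_sum_erase (flats M) _ ((mem_flats M).2 M.ground_isFlat)]
    congr 1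
    · simp [moebius_contract_ground, Matroid.restrict_ground_eq_self]
    · refine Finset.sum_congr rfl fun F hF => ?_
      rw [Finset.mem_erase, mem_flats] at hF
      rw [hproper F hF.2 hF.1]
  rw [hsplit] at hpal
  have hQ := inverseKL_isInverseKL.palindromic M
  rw [inverseZ_eq] at hQ
  have d1 := inverseKL_isInverseKL.degree_lt M hM
  have p1 := ((isPalindromic_iff _ _).1 hQ).2
  have p2 := ((isPalindromic_iff _ _).1 hpal).2
  ext k
  rcases lt_or_ge (2 * k) (rk M) with hk | hk
  · have e1 := p1 k (by omega)
    have e2 := p2 k (by omega)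
    simp only [Polynomial.coeff_add] at e1 e2
    rw [Polynomial.coeff_eq_zero_of_natDegree_lt (n := rk M - k) (by omega : _ < _)] at e1
    rw [Polynomial.coeff_eq_zero_of_natDegree_lt (p := h M.E) (n := rk M - k) (by omega)] at e2
    linarith
  · rw [Polynomial.coeff_eq_zero_of_natDegree_lt (by omega),
      Polynomial.coeff_eq_zero_of_natDegree_lt (by omega)]

theorem IsPalindromic.mul {c d : ℕ} {f g : ℤ[X]} (hf : IsPalindromic c f)
    (hg : IsPalindromic d g) : IsPalindromic (c + d) (f * g) :=
  ⟨Polynomial.natDegree_mul_le.trans (add_le_add hf.1 hg.1), by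
    rw [Polynomial.reflect_mul f g hf.1 hg.1, hf.2, hg.2]⟩

theorem IsPalindromic.add {d : ℕ} {f g : ℤ[X]} (hf : IsPalindromic d f)
    (hg : IsPalindromic d g) : IsPalindromic d (f + g) :=
  ⟨(Polynomial.natDegree_add_le _ _).trans (max_le hf.1 hg.1), by
    rw [Polynomial.reflect_add, hf.2, hg.2]⟩

theorem IsPalindromic.sub {d : ℕ} {f g : ℤ[X]} (hf : IsPalindromic d f)
    (hg : IsPalindromic d g) : IsPalindromic d (f - g) :=
  ⟨(Polynomial.natDegree_sub_le _ _).trans (max_le hf.1 hg.1), by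
    rw [Polynomial.reflect_sub, hf.2, hg.2]⟩

theorem isPalindromic_C (a : ℤ) : IsPalindromic 0 (Polynomial.C a) :=
  ⟨(Polynomial.natDegree_C a).le, by rw [Polynomial.reflect_C, pow_zero, mul_one]⟩

/-- The constant coefficient 0 mirrors the coefficient of `X ^ 2`, so a factor `X` raises the
palindromic degree by two. -/
theorem isPalindromic_X : IsPalindromic 2 (Polynomial.X : ℤ[X]) := by
  rw [isPalindromic_iff]
  refine ⟨Polynomial.natDegree_X_le.trans (by norm_num), fun k hk => ?_⟩
  interval_cases k <;> simp [Polynomial.coeff_X]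

theorem isPalindromic_one_add_X : IsPalindromic 1 (1 + Polynomial.X : ℤ[X]) := by
  rw [isPalindromic_iff]
  refine ⟨(Polynomial.natDegree_add_le _ _).trans (by simp), fun k hk => ?_⟩
  interval_cases k <;> simp [Polynomial.coeff_X, Polynomial.coeff_one]

/-! ### Gaussian binomial coefficients -/

/-- The Gaussian binomial coefficient, defined by the `q`-analogue of Pascal's rule. -/
def gaussBinom (q : ℕ) : ℕ → ℕ → ℤ
  | _, 0 => 1
  | 0, _ + 1 => 0
  | n + 1, k + 1 => gaussBinom q n k + (q : ℤ) ^ (k + 1) * gaussBinom q n (k + 1)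

/-- The product of the numbers `q ^ j - 1` for `1 ≤ j ≤ n`. -/
def qFact (q n : ℕ) : ℤ := ∏ j ∈ Finset.range n, ((q : ℤ) ^ (j + 1) - 1)

@[simp] theorem gaussBinom_zero_right (q n : ℕ) : gaussBinom q n 0 = 1 := by
  cases n <;> rfl

theorem gaussBinom_succ_succ (q n k : ℕ) : gaussBinom q (n + 1) (k + 1) =
    gaussBinom q n k + (q : ℤ) ^ (k + 1) * gaussBinom q n (k + 1) := rfl

theorem gaussBinom_eq_zero_of_lt (q : ℕ) {n k : ℕ} (h : n < k) : gaussBinom q n k = 0 := by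
  induction n generalizing k with
  | zero =>
    obtain ⟨k, rfl⟩ := Nat.exists_eq_succ_of_ne_zero h.ne'
    rfl
  | succ n ih =>
    obtain ⟨k, rfl⟩ := Nat.exists_eq_succ_of_ne_zero (Nat.zero_lt_of_lt h).ne'
    rw [Nat.succ_eq_add_one, gaussBinom_succ_succ, ih (by omega), ih (by omega)]
    simp

@[simp] theorem qFact_zero (q : ℕ) : qFact q 0 = 1 := rfl

theorem qFact_succ (q n : ℕ) : qFact q (n + 1) = qFact q n * ((q : ℤ) ^ (n + 1) - 1) :=
  Finset.prod_range_succ _ _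

theorem pow_succ_sub_one_ne_zero {q : ℕ} (hq : 1 < q) (n : ℕ) : (q : ℤ) ^ (n + 1) - 1 ≠ 0 := by
  have : (1 : ℤ) < (q : ℤ) ^ (n + 1) := one_lt_pow₀ (by exact_mod_cast hq) (by omega)
  omega

theorem qFact_ne_zero {q : ℕ} (hq : 1 < q) (n : ℕ) : qFact q n ≠ 0 :=
  Finset.prod_ne_zero_iff.2 fun j _ => pow_succ_sub_one_ne_zero hq j

@[simp] theorem gaussBinom_self (q n : ℕ) : gaussBinom q n n = 1 := by
  induction n with
  | zero => rfl
  | succ n ih => rw [gaussBinom_succ_succ, ih, gaussBinom_eq_zero_of_lt q (by omega)]; simp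

/-- The factorial formula, kept free of division. Pascal's rule reduces it to `q^(s+t) - 1 = (q^s -
1) + q^s (q^t - 1)` with `s = a + 1`, `t = b + 1`. -/
theorem gaussBinom_add_mul_qFact (q a b : ℕ) :
    gaussBinom q (a + b) a * qFact q a * qFact q b = qFact q (a + b) := by
  induction hn : a + b generalizing a b with
  | zero =>
    obtain ⟨rfl, rfl⟩ : a = 0 ∧ b = 0 := by omega
    simp
  | succ n ih =>
    rcases a with _ | a
    · obtain rfl : b = n + 1 := by omega
      simp
    rcases b with _ | b
    · obtain rfl : a = n := by omega
      simp
    have h1 := ih a (b + 1) (by omega)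
    have h2 := ih (a + 1) b (by omega)
    obtain rfl : n = a + b + 1 := by omega
    rw [gaussBinom_succ_succ, qFact_succ q (a + b + 1)]
    rw [qFact_succ q b] at h1
    rw [qFact_succ q a] at h2
    rw [qFact_succ q a, qFact_succ q b]
    have e : (q : ℤ) ^ (a + b + 1 + 1) = (q : ℤ) ^ (a + 1) * (q : ℤ) ^ (b + 1) := by ring
    rw [e]
    linear_combination ((q : ℤ) ^ (a + 1) - 1) * h1 +
      (q : ℤ) ^ (a + 1) * ((q : ℤ) ^ (b + 1) - 1) * h2

theorem gaussBinom_symm {q : ℕ} (hq : 1 < q) {n k : ℕ} (hk : k ≤ n) :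
    gaussBinom q n (n - k) = gaussBinom q n k := by
  obtain ⟨b, rfl⟩ := Nat.exists_eq_add_of_le hk
  rw [Nat.add_sub_cancel_left]
  have h1 := gaussBinom_add_mul_qFact q k b
  have h2 := gaussBinom_add_mul_qFact q b k
  rw [add_comm b k] at h2
  apply mul_right_cancel₀ (mul_ne_zero (qFact_ne_zero hq k) (qFact_ne_zero hq b))
  linear_combination h2 - h1

/-- The absorption identity, obtained by comparing factorial formulas; it removes the weight `[k]`
from sums over subspaces. -/
theorem gaussBinom_mul_qNumber {q : ℕ} (hq : 1 < q) (n k : ℕ) :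
    gaussBinom q (n + 1) (k + 1) * qNumber (k + 1) q =
      qNumber (n + 1) q * gaussBinom q n k := by
  have hq1 : (q : ℤ) - 1 ≠ 0 := by simpa using pow_succ_sub_one_ne_zero hq 0
  rcases lt_or_ge n k with h | h
  · rw [gaussBinom_eq_zero_of_lt q h, gaussBinom_eq_zero_of_lt q (by omega)]
    simp
  obtain ⟨b, rfl⟩ := Nat.exists_eq_add_of_le h
  have h1 := gaussBinom_add_mul_qFact q k b
  have h2 := gaussBinom_add_mul_qFact q (k + 1) b
  rw [show k + 1 + b = k + b + 1 by ring, qFact_succ, qFact_succ] at h2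
  apply mul_right_cancel₀ (mul_ne_zero hq1
    (mul_ne_zero (qFact_ne_zero hq k) (qFact_ne_zero hq b)))
  have e1 := qNumber_mul (k + 1) q
  have e2 := qNumber_mul (k + b + 1) q
  linear_combination (gaussBinom q (k + b + 1) (k + 1) * qFact q k * qFact q b) * e1 -
    (gaussBinom q (k + b) k * qFact q k * qFact q b) * e2 + h2 -
    ((q : ℤ) ^ (k + b + 1) - 1) * h1

/-- The alternating sum of Gaussian binomial coefficients that computes the Möbius function of the
lattice of subspaces. -/
theorem sum_neg_one_pow_mul_gaussBinom (q n : ℕ) :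
    ∑ k ∈ Finset.range (n + 2),
      gaussBinom q (n + 1) k * ((-1) ^ k * (q : ℤ) ^ k.choose 2) = 0 := by
  -- Pascal's rule makes the sum telescope; the surviving end value `-1` cancels the term at `k =
  -- 0`.
  have h : ∀ k, gaussBinom q (n + 1) (k + 1) * ((-1) ^ (k + 1) * (q : ℤ) ^ (k + 1).choose 2) =
      gaussBinom q n (k + 1) * ((-1) ^ (k + 1) * (q : ℤ) ^ ((k + 1).choose 2 + (k + 1))) -
        gaussBinom q n k * ((-1) ^ k * (q : ℤ) ^ (k.choose 2 + k)) := by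
    intro k
    have : (k + 1).choose 2 = k.choose 2 + k := by
      rw [Nat.choose_succ_succ' k 1, Nat.choose_one_right, add_comm]
    rw [gaussBinom_succ_succ, this]
    ring
  rw [Finset.sum_range_succ', Finset.sum_congr rfl fun k _ => h k,
    Finset.sum_range_sub (fun k => gaussBinom q n k * ((-1) ^ k * (q : ℤ) ^ (k.choose 2 + k))),
    gaussBinom_eq_zero_of_lt q (Nat.lt_succ_self n)]
  simp

theorem sum_neg_one_pow_sub_mul_gaussBinom {q : ℕ} (hq : 1 < q) {n : ℕ} (hn : 0 < n) :
    ∑ k ∈ Finset.range (n + 1),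
      gaussBinom q n k * ((-1) ^ (n - k) * (q : ℤ) ^ (n - k).choose 2) = 0 := by
  obtain ⟨n, rfl⟩ := Nat.exists_eq_succ_of_ne_zero hn.ne'
  rw [← Finset.sum_range_reflect, ← sum_neg_one_pow_mul_gaussBinom q n]
  refine Finset.sum_congr rfl fun k hk => ?_
  rw [Finset.mem_range] at hk
  rw [show n.succ + 1 - 1 - k = n + 1 - k by omega, gaussBinom_symm hq (by omega),
    show n.succ - (n + 1 - k) = k by omega]

/-- The sum over all subspaces of a vector space of dimension `n`, of codimension `c` and
dimension `d`, of `q ^ (c.choose 2 + d.choose 2) * X ^ c`. -/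
noncomputable def subspacePoly (q n : ℕ) : ℤ[X] :=
  ∑ k ∈ Finset.range (n + 1), Polynomial.C (gaussBinom q n k) *
    (Polynomial.C ((q : ℤ) ^ ((n - k).choose 2 + k.choose 2)) * Polynomial.X ^ (n - k))

/-- Both the Gaussian binomial and the exponent of `q` are invariant under `k ↔ n - k`. -/
theorem isPalindromic_subspacePoly {q : ℕ} (hq : 1 < q) (n : ℕ) :
    IsPalindromic n (subspacePoly q n) := by
  have h : subspacePoly q n = ∑ k ∈ Finset.range (n + 1),
      Polynomial.C (gaussBinom q n k * (q : ℤ) ^ ((n - k).choose 2 + k.choose 2)) *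
        Polynomial.X ^ k := by
    unfold subspacePoly
    rw [← Finset.sum_range_reflect]
    refine Finset.sum_congr rfl fun k hk => ?_
    rw [Finset.mem_range] at hk
    rw [show n + 1 - 1 - k = n - k by omega, gaussBinom_symm hq (by omega),
      show n - (n - k) = k by omega, add_comm, ← mul_assoc, ← Polynomial.C_mul]
  rw [isPalindromic_iff, h]
  constructor
  · refine Polynomial.natDegree_sum_le_of_forall_le _ _ fun k hk => ?_
    rw [Finset.mem_range] at hk
    exact (Polynomial.natDegree_C_mul_X_pow_le _ _).trans (by omega)
  · intro k hk
    simp only [Polynomial.finsetSum_coeff, Polynomial.coeff_C_mul_X_pow]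
    rw [Finset.sum_ite_eq, Finset.sum_ite_eq, if_pos (by simp),
      if_pos (by simp; omega), gaussBinom_symm hq hk, show n - (n - k) = k by omega, add_comm]

/-- Weighting the subspaces by their numbers of points. -/
theorem sum_gaussBinom_mul_qNumber {q : ℕ} (hq : 1 < q) (n : ℕ) :
    ∑ k ∈ Finset.range (n + 2), Polynomial.C (gaussBinom q (n + 1) k) *
      (Polynomial.C (qNumber k q * (q : ℤ) ^ ((n + 1 - k).choose 2 + (k - 1).choose 2)) *
        Polynomial.X ^ (n + 1 - k)) = Polynomial.C (qNumber (n + 1) q) * subspacePoly q n := by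
  rw [Finset.sum_range_succ']
  -- The term at `k = 0` vanishes, so the truncated `k - 1` there is harmless.
  have h0 : qNumber 0 q = 0 := by simp [qNumber]
  rw [h0, subspacePoly, Finset.mul_sum]
  simp only [zero_mul, Polynomial.C_0, mul_zero, add_zero]
  refine Finset.sum_congr rfl fun k _ => ?_
  have h := gaussBinom_mul_qNumber hq n k
  rw [Nat.add_sub_add_right, Nat.add_sub_cancel, Polynomial.C_mul]
  have h' := congrArg (Polynomial.C (R := ℤ)) h
  rw [Polynomial.C_mul, Polynomial.C_mul] at h'
  linear_combination (Polynomial.C ((q : ℤ) ^ ((n - k).choose 2 + k.choose 2)) *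
    Polynomial.X ^ (n - k)) * h'

/-! ### Counting subspaces of a vector space over a finite field -/

section CountSubspaces

variable {K V : Type*} [Field K] [AddCommGroup V] [Module K V] [Finite V]

/-- Pulling `q ^ i` out of each factor leaves the top `a` factors of `qFact q (a + b)`. -/
theorem prod_pow_sub_pow_mul_qFact (q a b : ℕ) :
    (∏ i ∈ Finset.range a, ((q : ℤ) ^ (a + b) - (q : ℤ) ^ i)) * qFact q b =
      (∏ i ∈ Finset.range a, (q : ℤ) ^ i) * qFact q (a + b) := by
  induction a generalizing b with
  | zero => simp
  | succ a ih =>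
    have h := ih (b + 1)
    rw [qFact_succ] at h
    rw [Finset.prod_range_succ, Finset.prod_range_succ, show a + 1 + b = a + (b + 1) by ring]
    rw [show (q : ℤ) ^ (a + (b + 1)) - (q : ℤ) ^ a = (q : ℤ) ^ a * ((q : ℤ) ^ (b + 1) - 1) by ring]
    linear_combination (q : ℤ) ^ a * h

theorem card_linearIndependent_cast [Finite K] (k : ℕ) (hk : k ≤ Module.finrank K V) :
    (Nat.card {s : Fin k → V // LinearIndependent K s} : ℤ) =
      ∏ i ∈ Finset.range k, ((Nat.card K : ℤ) ^ Module.finrank K V - (Nat.card K : ℤ) ^ i) := by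
  have := Fintype.ofFinite K
  rw [card_linearIndependent hk, Nat.cast_prod, Finset.prod_range, Nat.card_eq_fintype_card]
  refine Finset.prod_congr rfl fun i _ => ?_
  rw [Nat.cast_sub, Nat.cast_pow, Nat.cast_pow]
  exact Nat.pow_le_pow_right Fintype.card_pos (i.2.le.trans hk)

/-- Linearly independent `k`-tuples are the bases of the subspaces of dimension `k`. -/
noncomputable def linearIndependentEquivSigma (K V : Type*) [Field K] [AddCommGroup V] [Module K V]
    [Finite V] (k : ℕ) :
    {s : Fin k → V // LinearIndependent K s} ≃
      (Σ U : {U : Submodule K V // Module.finrank K U = k},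
        {s : Fin k → U.1 // LinearIndependent K s}) where
  toFun s := ⟨⟨Submodule.span K (Set.range s.1), by
      rw [finrank_span_eq_card s.2, Fintype.card_fin]⟩,
    ⟨fun j => ⟨s.1 j, Submodule.subset_span ⟨j, rfl⟩⟩,
      LinearIndependent.of_comp (Submodule.subtype _) s.2⟩⟩
  invFun p := ⟨fun j => p.2.1 j, p.2.2.map' p.1.1.subtype p.1.1.ker_subtype⟩
  left_inv s := rfl
  right_inv p := by
    -- Comparing underlying subspaces and vectors avoids transport along an equality of subspaces.
    have hext : ∀ p p' : (Σ U : {U : Submodule K V // Module.finrank K U = k},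
        {s : Fin k → U.1 // LinearIndependent K s}), p.1.1 = p'.1.1 →
        (∀ j, (p.2.1 j : V) = p'.2.1 j) → p = p' := by
      rintro ⟨⟨U, hU⟩, ⟨s, hs⟩⟩ ⟨⟨U', hU'⟩, ⟨s', hs'⟩⟩ h h'
      obtain rfl : U = U' := h
      obtain rfl : s = s' := funext fun j => Subtype.ext (h' j)
      rfl
    refine hext _ _ ?_ fun j => rfl
    have hs : LinearIndependent K fun j => (p.2.1 j : V) :=
      p.2.2.map' p.1.1.subtype p.1.1.ker_subtype
    apply Submodule.eq_of_le_of_finrank_eq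
    · rw [Submodule.span_le]
      rintro _ ⟨j, rfl⟩
      exact (p.2.1 j).2
    · rw [finrank_span_eq_card hs, Fintype.card_fin, p.1.2]

theorem card_finrank_eq_zero_of_lt {k : ℕ} (hk : Module.finrank K V < k) :
    Nat.card {U : Submodule K V // Module.finrank K U = k} = 0 := by
  have : IsEmpty {U : Submodule K V // Module.finrank K U = k} :=
    ⟨fun U => absurd (U.2 ▸ Submodule.finrank_le U.1) (not_le.2 hk)⟩
  exact Nat.card_of_isEmpty

/-- Double counting of independent `k`-tuples: every `k`-dimensional subspace has the same number of
ordered bases. -/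
theorem card_finrank_eq [Finite K] (k : ℕ) :
    (Nat.card {U : Submodule K V // Module.finrank K U = k} : ℤ) =
      gaussBinom (Nat.card K) (Module.finrank K V) k := by
  rcases lt_or_ge (Module.finrank K V) k with hk | hk
  · rw [card_finrank_eq_zero_of_lt hk, gaussBinom_eq_zero_of_lt _ hk, Nat.cast_zero]
  have hq : 1 < Nat.card K := Finite.one_lt_card
  have := Fintype.ofFinite {U : Submodule K V // Module.finrank K U = k}
  have h1 := card_linearIndependent_cast (K := K) (V := V) k hk
  rw [Nat.card_congr (linearIndependentEquivSigma K V k), Nat.card_sigma, Nat.cast_sum] at h1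
  have h2 : ∀ U : {U : Submodule K V // Module.finrank K U = k},
      (Nat.card {s : Fin k → U.1 // LinearIndependent K s} : ℤ) =
        ∏ i ∈ Finset.range k, ((Nat.card K : ℤ) ^ k - (Nat.card K : ℤ) ^ i) := by
    rintro ⟨U, hU⟩
    rw [card_linearIndependent_cast k hU.ge, hU]
  rw [Finset.sum_congr rfl fun U _ => h2 U, Finset.sum_const, Finset.card_univ, nsmul_eq_mul,
    ← Nat.card_eq_fintype_card] at h1
  obtain ⟨b, hb⟩ := Nat.exists_eq_add_of_le hk
  rw [hb] at h1 ⊢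
  have h3 := prod_pow_sub_pow_mul_qFact (Nat.card K) k 0
  have h4 := prod_pow_sub_pow_mul_qFact (Nat.card K) k b
  have h5 := gaussBinom_add_mul_qFact (Nat.card K) k b
  rw [add_zero, qFact_zero, mul_one] at h3
  have hP : (∏ i ∈ Finset.range k, (Nat.card K : ℤ) ^ i) ≠ 0 :=
    Finset.prod_ne_zero_iff.2 fun i _ => pow_ne_zero _ (by exact_mod_cast (by omega))
  apply mul_right_cancel₀ (mul_ne_zero hP
    (mul_ne_zero (qFact_ne_zero hq k) (qFact_ne_zero hq b)))
  rw [h3] at h1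
  linear_combination qFact (Nat.card K) b * h1 + h4 -
    (∏ i ∈ Finset.range k, (Nat.card K : ℤ) ^ i) * h5

theorem finrank_comap_mkQ (S : Submodule K V) (U : Submodule K (V ⧸ S)) :
    Module.finrank K (U.comap S.mkQ) = Module.finrank K S + Module.finrank K U := by
  have h1 := (U.comap S.mkQ).finrank_quotient_add_finrank
  have h2 := U.finrank_quotient_add_finrank
  have h3 := S.finrank_quotient_add_finrank
  have hle : S ≤ U.comap S.mkQ := Submodule.le_comap_mkQ S U
  have h4 := (Submodule.quotientQuotientEquivQuotient S (U.comap S.mkQ) hle).finrank_eq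
  rw [Submodule.map_comap_eq_of_surjective S.mkQ_surjective] at h4
  omega

open scoped Classical in
theorem sum_submodule_finrank [Finite K] [Fintype (Submodule K V)] {R : Type*} [CommRing R] (f : ℕ → R) :
    ∑ U : Submodule K V, f (Module.finrank K U) =
      ∑ k ∈ Finset.range (Module.finrank K V + 1),
        (gaussBinom (Nat.card K) (Module.finrank K V) k : R) * f k := by
  rw [← Finset.sum_fiberwise_of_maps_to (s := Finset.univ)
    (t := Finset.range (Module.finrank K V + 1)) (g := fun U : Submodule K V => Module.finrank K U)
    fun U _ => Finset.mem_range.2 (Nat.lt_succ_of_le U.finrank_le)]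
  refine Finset.sum_congr rfl fun k _ => ?_
  rw [Finset.sum_congr rfl fun U hU => by rw [(Finset.mem_filter.1 hU).2], Finset.sum_const,
    nsmul_eq_mul, ← card_finrank_eq, Nat.card_eq_fintype_card, Fintype.card_subtype]
  simp

open scoped Classical in
-- The interval from `T` to `W` is the lattice of subspaces of `W / T`, with dimensions shifted by
-- that of `T`.
theorem sum_submodule_interval [Finite K] [Fintype (Submodule K V)] {R : Type*} [CommRing R]
    {T W : Submodule K V} (hTW : T ≤ W) (f : ℕ → R) :
    ∑ U : Submodule K V with T ≤ U ∧ U ≤ W, f (Module.finrank K U) =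
      ∑ k ∈ Finset.range (Module.finrank K W - Module.finrank K T + 1),
        (gaussBinom (Nat.card K) (Module.finrank K W - Module.finrank K T) k : R) *
          f (Module.finrank K T + k) := by
  let S : Submodule K W := T.comap W.subtype
  have hS : Module.finrank K S = Module.finrank K T :=
    (Submodule.comapSubtypeEquivOfLe hTW).finrank_eq
  have hquot : Module.finrank K (W ⧸ S) = Module.finrank K W - Module.finrank K T := by
    have := S.finrank_quotient_add_finrank
    omega
  have : Finite (W ⧸ S) := Finite.of_surjective _ S.mkQ_surjective
  have : Finite (Submodule K (W ⧸ S)) := Finite.of_injective _ SetLike.coe_injective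
  have := Fintype.ofFinite (Submodule K (W ⧸ S))
  rw [← hquot, ← sum_submodule_finrank (fun k => f (Module.finrank K T + k))]
  symm
  refine Finset.sum_nbij (fun U => (U.comap S.mkQ).map W.subtype) ?_ ?_ ?_ ?_
  · intro U _
    simp only [Finset.mem_filter, Finset.mem_univ, true_and]
    refine ⟨?_, Submodule.map_subtype_le _ _⟩
    intro x hx
    exact ⟨⟨x, hTW hx⟩, Submodule.le_comap_mkQ S U hx, rfl⟩
  · intro U _ U' _ h
    exact Submodule.comap_injective_of_surjective S.mkQ_surjective
      (Submodule.map_injective_of_injective W.injective_subtype h)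
  · intro U hU
    simp only [Finset.coe_filter, Finset.mem_univ, true_and, Set.mem_ofPred_eq] at hU
    refine ⟨(U.comap W.subtype).map S.mkQ, Finset.mem_coe.2 (Finset.mem_univ _), ?_⟩
    change Submodule.map _ (Submodule.comap _ (Submodule.map _ _)) = U
    rw [Submodule.comap_map_mkQ, sup_eq_right.2 (Submodule.comap_mono hU.1),
      Submodule.map_comap_subtype, inf_eq_right.2 hU.2]
  · intro U _
    rw [Submodule.finrank_map_subtype_eq, finrank_comap_mkQ, hS]

end CountSubspaces

/-! ### Restrictions of projective geometries -/

section Restrictions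

variable {K : Type u} [Field K] {r : ℕ}

/-- The subspace spanned by a set of points. -/
noncomputable def pointSpan (S : Set (ℙ K (Fin r → K))) : Submodule K (Fin r → K) :=
  Submodule.span K (Projectivization.rep '' S)

/-- The set of points of a subspace. -/
def points (W : Submodule K (Fin r → K)) : Set (ℙ K (Fin r → K)) := {p | p.rep ∈ W}

theorem mem_points {W : Submodule K (Fin r → K)} {p : ℙ K (Fin r → K)} :
    p ∈ points W ↔ p.rep ∈ W := Iff.rfl

theorem points_mono {U W : Submodule K (Fin r → K)} (h : U ≤ W) : points U ⊆ points W :=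
  fun _ hp => h hp

theorem pointSpan_mono {S T : Set (ℙ K (Fin r → K))} (h : S ⊆ T) : pointSpan S ≤ pointSpan T :=
  Submodule.span_mono (Set.image_mono h)

theorem pointSpan_le_iff {S : Set (ℙ K (Fin r → K))} {W : Submodule K (Fin r → K)} :
    pointSpan S ≤ W ↔ S ⊆ points W := by
  rw [pointSpan, Submodule.span_le, Set.image_subset_iff]
  rfl

theorem subset_points_pointSpan (S : Set (ℙ K (Fin r → K))) : S ⊆ points (pointSpan S) :=
  pointSpan_le_iff.1 le_rfl

theorem mk_rep_mem_iff {U : Submodule K (Fin r → K)} {v : Fin r → K} (hv : v ≠ 0) :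
    (Projectivization.mk K v hv).rep ∈ U ↔ v ∈ U := by
  obtain ⟨a, ha⟩ := Projectivization.exists_smul_eq_mk_rep K v hv
  rw [← ha]
  exact U.smul_mem_iff_of_isUnit a.isUnit

theorem pointSpan_points (W : Submodule K (Fin r → K)) : pointSpan (points W) = W := by
  apply le_antisymm (pointSpan_le_iff.2 subset_rfl)
  intro v hv
  by_cases h0 : v = 0
  · rw [h0]; exact zero_mem _
  rw [← mk_rep_mem_iff h0] at hv ⊢
  exact subset_points_pointSpan _ hv

theorem mk_ne_of_notMem_span {i : ℙ K (Fin r → K)} {v : Fin r → K} (hv : v ≠ 0)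
    (h : v ∉ Submodule.span K {i.rep}) : Projectivization.mk K v hv ≠ i := by
  rintro rfl
  apply h
  rw [← mk_rep_mem_iff hv]
  exact Submodule.mem_span_singleton_self _

theorem pointSpan_points_sdiff_singleton {i : ℙ K (Fin r → K)} {W : Submodule K (Fin r → K)}
    (hW : W ≠ Submodule.span K {i.rep}) : pointSpan (points W \ {i}) = W := by
  apply le_antisymm (pointSpan_le_iff.2 Set.sdiff_subset)
  have key : ∀ v ∈ W, v ∉ Submodule.span K {i.rep} → v ∈ pointSpan (points W \ {i}) := by
    intro v hv hvi
    have h0 : v ≠ 0 := fun h => hvi (h ▸ zero_mem _)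
    rw [← mk_rep_mem_iff h0] at hv ⊢
    exact subset_points_pointSpan _ ⟨hv, mk_ne_of_notMem_span h0 hvi⟩
  intro v hv
  by_cases hvi : v ∈ Submodule.span K {i.rep}
  swap
  · exact key v hv hvi
  by_cases hle : W ≤ Submodule.span K {i.rep}
  · rcases (nonzero_span_atom i.rep i.rep_nonzero).le_iff.1 hle with h | h
    · rw [h, Submodule.mem_bot] at hv
      rw [hv]
      exact zero_mem _
    · exact absurd h hW
  · obtain ⟨w, hw, hwi⟩ := SetLike.not_le_iff_exists.1 hle
    -- A vector `v` on the removed line is `(v + w) - w`, where neither `w` nor `v + w` lies on that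
    -- line.
    have h1 := key (v + w) (add_mem hv hw) fun h => hwi ((Submodule.add_mem_iff_right _ hvi).1 h)
    simpa using sub_mem h1 (key w hw hwi)

theorem pointSpan_points_span_sdiff_singleton (i : ℙ K (Fin r → K)) :
    pointSpan (points (Submodule.span K {i.rep}) \ {i}) = ⊥ := by
  have h : points (Submodule.span K {i.rep}) \ {i} = ∅ := by
    rw [Set.eq_empty_iff_forall_notMem]
    rintro p ⟨hp, hpi⟩
    apply hpi
    obtain ⟨a, ha⟩ := Submodule.mem_span_singleton.1 (mem_points.1 hp)
    rw [Set.mem_singleton_iff, ← p.mk_rep, ← i.mk_rep, Projectivization.mk_eq_mk_iff']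
    exact ⟨a, ha⟩
  rw [h, pointSpan, Set.image_empty, Submodule.span_empty]

variable [Finite K]

instance finite_projectivization : Finite (ℙ K (Fin r → K)) := Quotient.finite _

theorem PG_indep_iff {I : Set (ℙ K (Fin r → K))} :
    (PG K r).Indep I ↔ LinearIndepOn K Projectivization.rep I := by
  simp only [PG, IndepMatroid.matroid_Indep, IndepMatroid.ofFinite_indep,
    Projectivization.independent_iff]
  rfl

theorem pointSpan_eq_of_isBasis {I S : Set (ℙ K (Fin r → K))} (hI : (PG K r).IsBasis I S) :
    pointSpan I = pointSpan S := by
  apply le_antisymm (pointSpan_mono hI.subset)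
  rw [pointSpan_le_iff]
  intro e he
  by_contra hns
  have hins : (PG K r).Indep (insert e I) :=
    PG_indep_iff.2 ((PG_indep_iff.1 hI.indep).insert hns)
  exact hns (subset_points_pointSpan I (hI.mem_of_insert_indep he hins))

theorem PG_closure (S : Set (ℙ K (Fin r → K))) :
    (PG K r).closure S = points (pointSpan S) := by
  obtain ⟨I, hI⟩ := (PG K r).exists_isBasis S (Set.subset_univ S)
  rw [← hI.closure_eq_closure, ← pointSpan_eq_of_isBasis hI]
  ext e
  rw [hI.indep.mem_closure_iff']
  have h1 := PG_indep_iff.1 hI.indep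
  constructor
  · rintro ⟨-, h⟩
    by_contra hns
    exact hns (subset_points_pointSpan I (h (PG_indep_iff.2 (h1.insert hns))))
  · intro h
    refine ⟨Set.mem_univ e, fun h2 => ?_⟩
    by_contra heI
    exact (linearIndepOn_insert heI).1 (PG_indep_iff.1 h2) |>.2 h

theorem PG_eRk (S : Set (ℙ K (Fin r → K))) :
    (PG K r).eRk S = Module.finrank K (pointSpan S) := by
  obtain ⟨I, hI⟩ := (PG K r).exists_isBasis S (Set.subset_univ S)
  have := Fintype.ofFinite I
  rw [← hI.encard_eq_eRk, ← pointSpan_eq_of_isBasis hI, pointSpan, Set.image_eq_range,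
    finrank_span_eq_card (PG_indep_iff.1 hI.indep), ← Set.toFinset_card, Set.encard_eq_coe_toFinset_card]

theorem rk_PG_restrict (S : Set (ℙ K (Fin r → K))) :
    rk (PG K r ↾ S) = Module.finrank K (pointSpan S) := by
  rw [rk, Matroid.eRank_restrict, PG_eRk, ENat.toNat_natCast]

instance loopless_PG_restrict (S : Set (ℙ K (Fin r → K))) : (PG K r ↾ S).Loopless := by
  rw [Matroid.loopless_iff_forall_isNonloop]
  intro e he
  rw [← Matroid.indep_singleton, Matroid.restrict_indep_iff, PG_indep_iff]
  exact ⟨LinearIndepOn.singleton e.rep_nonzero, Set.singleton_subset_iff.2 he⟩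

theorem isFlat_PG_restrict_iff {S F : Set (ℙ K (Fin r → K))} :
    (PG K r ↾ S).IsFlat F ↔ points (pointSpan F) ∩ S = F := by
  rw [Matroid.isFlat_iff_closure_eq]
  constructor
  · intro h
    have hFS : F ⊆ S := h ▸ (PG K r ↾ S).closure_subset_ground F
    rwa [(PG K r).restrict_closure_eq hFS (Set.subset_univ S), PG_closure] at h
  · intro h
    have hFS : F ⊆ S := h ▸ Set.inter_subset_right
    rwa [(PG K r).restrict_closure_eq hFS (Set.subset_univ S), PG_closure]

theorem isFlat_points_inter (U : Submodule K (Fin r → K)) (S : Set (ℙ K (Fin r → K))) :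
    (PG K r ↾ S).IsFlat (points U ∩ S) := by
  rw [isFlat_PG_restrict_iff]
  refine subset_antisymm (Set.inter_subset_inter_left S (points_mono ?_))
    (Set.subset_inter (subset_points_pointSpan _) Set.inter_subset_right)
  exact pointSpan_le_iff.2 Set.inter_subset_left

open scoped Classical in
/-- The flats of `PG ↾ S` correspond to the subspaces that are spanned by points of `S`. -/
theorem sum_flats_PG_restrict [Fintype (Submodule K (Fin r → K))] {R : Type*} [AddCommMonoid R]
    (S : Set (ℙ K (Fin r → K))) (p : Submodule K (Fin r → K) → Prop)
    (f : Submodule K (Fin r → K) → R) :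
    ∑ F ∈ flats (PG K r ↾ S) with p (pointSpan F), f (pointSpan F) =
      ∑ U with pointSpan (points U ∩ S) = U ∧ p U, f U := by
  refine Finset.sum_bij (fun F _ => pointSpan F) ?_ ?_ ?_ fun _ _ => rfl
  · intro F hF
    rw [Finset.mem_filter, mem_flats, isFlat_PG_restrict_iff] at hF
    simp only [Finset.mem_filter, Finset.mem_univ, true_and]
    exact ⟨by rw [hF.1], hF.2⟩
  · intro F hF G hG h
    rw [Finset.mem_filter, mem_flats, isFlat_PG_restrict_iff] at hF hG
    rw [← hF.1, ← hG.1, h]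
  · intro U hU
    simp only [Finset.mem_filter, Finset.mem_univ, true_and] at hU
    refine ⟨points U ∩ S, ?_, hU.1⟩
    rw [Finset.mem_filter, mem_flats, hU.1]
    exact ⟨isFlat_points_inter U S, hU.2⟩

theorem eq_of_pointSpan_eq {S F : Set (ℙ K (Fin r → K))} (hF : (PG K r ↾ S).IsFlat F)
    (h : pointSpan F = pointSpan S) : F = S := by
  rw [isFlat_PG_restrict_iff, h] at hF
  rw [← hF, Set.inter_eq_right]
  exact subset_points_pointSpan S

/-- On flats, inclusion is equivalent to inclusion of spans, so the Möbius recursion can be verified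
on spanned subspaces. -/
theorem moebius_PG_restrict_contract [Fintype (Submodule K (Fin r → K))]
    (S : Set (ℙ K (Fin r → K))) (g : Submodule K (Fin r → K) → ℤ) (hS : g (pointSpan S) = 1)
    (hg : ∀ T, pointSpan (points T ∩ S) = T → T ≠ pointSpan S →
      open scoped Classical in ∑ U with pointSpan (points U ∩ S) = U ∧ T ≤ U, g U = 0)
    {F : Set (ℙ K (Fin r → K))} (hF : (PG K r ↾ S).IsFlat F) :
    moebius ((PG K r ↾ S) ／ F) = g (pointSpan F) := by
  classical
  refine moebius_contract_eq_of_sum_eq_zero (PG K r ↾ S) (fun F => g (pointSpan F)) hS ?_ hF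
  intro F hF hFS
  have h1 : pointSpan F ≠ pointSpan S := fun h => hFS (eq_of_pointSpan_eq hF h)
  have h2 := isFlat_PG_restrict_iff.1 hF
  rw [← hg (pointSpan F) (by rw [h2]) h1, ← sum_flats_PG_restrict S (pointSpan F ≤ ·) g]
  refine Finset.sum_congr (Finset.filter_congr fun G hG => ?_) fun _ _ => rfl
  rw [mem_flats, isFlat_PG_restrict_iff] at hG
  refine ⟨pointSpan_mono, fun h => ?_⟩
  rw [← h2, ← hG]
  exact Set.inter_subset_inter_left S (points_mono h)

/-- A criterion for the inverse Kazhdan-Lusztig polynomial of `PG ↾ S`, in terms of subspaces. -/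
theorem inverseKL_PG_restrict_eq [Fintype (Submodule K (Fin r → K))]
    (S : Set (ℙ K (Fin r → K))) (n : ℕ) (hn : Module.finrank K (pointSpan S) = n) (hn0 : 0 < n)
    (g : Submodule K (Fin r → K) → ℤ) (hS : g (pointSpan S) = 1)
    (hg : ∀ T, pointSpan (points T ∩ S) = T → T ≠ pointSpan S →
      open scoped Classical in ∑ U with pointSpan (points U ∩ S) = U ∧ T ≤ U, g U = 0)
    (h : Submodule K (Fin r → K) → ℤ[X])
    (hproper : ∀ U, pointSpan (points U ∩ S) = U → U < pointSpan S →
      inverseKL (PG K r ↾ (points U ∩ S)) = h U)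
    (hdeg : 2 * (h (pointSpan S)).natDegree < n)
    (hpal : open scoped Classical in
      IsPalindromic n (∑ U with pointSpan (points U ∩ S) = U,
        Polynomial.C ((-1) ^ (n - Module.finrank K U) * g U) *
          Polynomial.X ^ (n - Module.finrank K U) * h U)) :
    inverseKL (PG K r ↾ S) = h (pointSpan S) := by
  classical
  have hrk : rk (PG K r ↾ S) = n := (rk_PG_restrict S).trans hn
  refine inverseKL_eq_of_isPalindromic (PG K r ↾ S) (hrk.symm ▸ hn0) (fun F => h (pointSpan F))
    ?_ (hrk.symm ▸ hdeg) ?_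
  · intro F hF hFS
    have hne : pointSpan F ≠ pointSpan S := fun h => hFS (eq_of_pointSpan_eq hF h)
    have hFS' : F ⊆ S := hF.subset_ground
    have h2 := isFlat_PG_restrict_iff.1 hF
    rw [Matroid.restrict_restrict_eq _ hFS', ← hproper (pointSpan F) (by rw [h2])
      (lt_of_le_of_ne (pointSpan_mono hFS') hne), h2]
  · rw [hrk]
    have hsum := sum_flats_PG_restrict S (fun _ => True) fun U =>
      Polynomial.C ((-1) ^ (n - Module.finrank K U) * g U) *
          Polynomial.X ^ (n - Module.finrank K U) * h U
    simp only [and_true, Finset.filter_true] at hsum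
    rw [← hsum] at hpal
    refine Eq.mp (congrArg _ (Finset.sum_congr rfl fun F hF => ?_)) hpal
    rw [mem_flats] at hF
    have hFS' : F ⊆ S := hF.subset_ground
    rw [moebius_PG_restrict_contract S g hS hg hF, Matroid.restrict_restrict_eq _ hFS',
      rk_PG_restrict]

end Restrictions

/-! ### Projective geometries and their single element deletions -/

section Deletion

variable {K : Type u} [Field K] {r : ℕ}

theorem pointSpan_points_inter_points {U W : Submodule K (Fin r → K)} :
    pointSpan (points U ∩ points W) = U ↔ U ≤ W := by
  have h : points U ∩ points W = points (U ⊓ W) := rfl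
  rw [h, pointSpan_points, inf_eq_left]

theorem points_inter_sdiff_singleton {U W : Submodule K (Fin r → K)} (hUW : U ≤ W)
    (i : ℙ K (Fin r → K)) : points U ∩ (points W \ {i}) = points U \ {i} := by
  rw [← Set.inter_sdiff_assoc, Set.inter_eq_left.2 (points_mono hUW)]

theorem pointSpan_points_inter_sdiff_singleton {U W : Submodule K (Fin r → K)}
    {i : ℙ K (Fin r → K)} :
    pointSpan (points U ∩ (points W \ {i})) = U ↔ U ≤ W ∧ U ≠ Submodule.span K {i.rep} := by
  constructor
  · intro h
    have hUW : U ≤ W := by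
      rw [← h, pointSpan_le_iff]
      exact Set.inter_subset_right.trans Set.sdiff_subset
    refine ⟨hUW, ?_⟩
    rintro rfl
    rw [points_inter_sdiff_singleton hUW, pointSpan_points_span_sdiff_singleton] at h
    exact i.rep_nonzero (Submodule.span_singleton_eq_bot.1 h.symm)
  · rintro ⟨hUW, hU⟩
    rw [points_inter_sdiff_singleton hUW, pointSpan_points_sdiff_singleton hU]

theorem span_rep_le_iff {i : ℙ K (Fin r → K)} {U : Submodule K (Fin r → K)} :
    Submodule.span K {i.rep} ≤ U ↔ i.rep ∈ U := by
  rw [Submodule.span_le, Set.singleton_subset_iff, SetLike.mem_coe]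

theorem finrank_span_rep (i : ℙ K (Fin r → K)) :
    Module.finrank K (Submodule.span K {i.rep}) = 1 := finrank_span_singleton i.rep_nonzero

open scoped Classical in
theorem sum_le_and_ne_add [Fintype (Submodule K (Fin r → K))] {R : Type*} [AddCommMonoid R]
    {L W : Submodule K (Fin r → K)} (hLW : L ≤ W) (f : Submodule K (Fin r → K) → R) :
    ∑ U with U ≤ W ∧ U ≠ L, f U + f L = ∑ U with U ≤ W, f U := by
  rw [← Finset.sum_erase_add (Finset.univ.filter (· ≤ W)) f (a := L) (by simp [hLW])]
  congr 2
  ext U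
  simp [and_comm]

variable [Finite K]

instance finite_submodule : Finite (Submodule K (Fin r → K)) :=
  Finite.of_injective _ SetLike.coe_injective

open scoped Classical in
/-- The Möbius function of the lattice of subspaces. -/
theorem sum_interval_moebius [Fintype (Submodule K (Fin r → K))]
    {T W : Submodule K (Fin r → K)} (hTW : T < W) :
    ∑ U with T ≤ U ∧ U ≤ W, (-1 : ℤ) ^ (Module.finrank K W - Module.finrank K U) *
      (Nat.card K : ℤ) ^ (Module.finrank K W - Module.finrank K U).choose 2 = 0 := by
  have hlt := Submodule.finrank_lt_finrank_of_lt hTW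
  rw [sum_submodule_interval hTW.le fun d => (-1 : ℤ) ^ (Module.finrank K W - d) *
    (Nat.card K : ℤ) ^ (Module.finrank K W - d).choose 2,
    ← sum_neg_one_pow_sub_mul_gaussBinom (q := Nat.card K) Finite.one_lt_card
      (Nat.sub_pos_of_lt hlt)]
  refine Finset.sum_congr rfl fun k _ => ?_
  rw [Nat.sub_sub, Int.cast_id]

open scoped Classical in
-- The left side is `Y` of the geometry on `W`, once its sign has cancelled the sign of the Möbius
-- function.
theorem sum_subspaces_eq_subspacePoly [Fintype (Submodule K (Fin r → K))]
    (W : Submodule K (Fin r → K)) :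
    ∑ U with U ≤ W, Polynomial.C ((Nat.card K : ℤ) ^
        (Module.finrank K W - Module.finrank K U).choose 2) *
      Polynomial.X ^ (Module.finrank K W - Module.finrank K U) *
        Polynomial.C ((Nat.card K : ℤ) ^ (Module.finrank K U).choose 2) =
      subspacePoly (Nat.card K) (Module.finrank K W) := by
  have h := sum_submodule_interval (bot_le : (⊥ : Submodule K (Fin r → K)) ≤ W) fun d =>
    Polynomial.C ((Nat.card K : ℤ) ^ (Module.finrank K W - d).choose 2) *
      Polynomial.X ^ (Module.finrank K W - d) * Polynomial.C ((Nat.card K : ℤ) ^ d.choose 2)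
  simp only [bot_le, true_and] at h
  rw [h, subspacePoly, finrank_bot, Nat.sub_zero]
  refine Finset.sum_congr rfl fun k _ => ?_
  rw [zero_add, pow_add, Polynomial.C_mul, ← eq_intCast Polynomial.C (gaussBinom _ _ _)]
  ring

/-- The inverse Kazhdan-Lusztig polynomials of projective geometries. -/
theorem inverseKL_PG_restrict_points (W : Submodule K (Fin r → K)) :
    inverseKL (PG K r ↾ points W) =
      Polynomial.C ((Nat.card K : ℤ) ^ (Module.finrank K W).choose 2) := by
  classical
  have := Fintype.ofFinite (Submodule K (Fin r → K))
  induction hn : Module.finrank K W using Nat.strong_induction_on generalizing W with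
  | _ n ih =>
  rcases Nat.eq_zero_or_pos n with rfl | hn0
  · rw [inverseKL_isInverseKL.rank_zero (PG K r ↾ points W)
      (by rw [rk_PG_restrict, pointSpan_points, hn])]
    simp
  let g : Submodule K (Fin r → K) → ℤ := fun U => (-1) ^ (n - Module.finrank K U) *
    (Nat.card K : ℤ) ^ (n - Module.finrank K U).choose 2
  have key := inverseKL_PG_restrict_eq (points W) n (by rw [pointSpan_points, hn]) hn0
    g (by simp [g, pointSpan_points, hn]) ?_
    (fun U => Polynomial.C ((Nat.card K : ℤ) ^ (Module.finrank K U).choose 2)) ?_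
    (by rw [Polynomial.natDegree_C]; omega) ?_
  · rw [key, pointSpan_points, hn]
  · intro T hT hTW
    rw [pointSpan_points_inter_points] at hT
    rw [pointSpan_points] at hTW
    have h := sum_interval_moebius (lt_of_le_of_ne hT hTW)
    rw [hn] at h
    rw [← h]
    refine Finset.sum_congr (Finset.filter_congr fun U _ => ?_) fun _ _ => rfl
    rw [pointSpan_points_inter_points, and_comm]
  · intro U hU hUW
    rw [pointSpan_points_inter_points] at hU
    rw [pointSpan_points] at hUW
    rw [Set.inter_eq_left.2 (points_mono hU)]
    exact ih _ (hn ▸ Submodule.finrank_lt_finrank_of_lt hUW) U rfl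
  · have h := sum_subspaces_eq_subspacePoly W
    rw [hn] at h
    have hpal := isPalindromic_subspacePoly (q := Nat.card K) Finite.one_lt_card n
    rw [← h] at hpal
    refine Eq.mp (congrArg _ (Finset.sum_congr (Finset.filter_congr fun U _ => ?_)
      fun U _ => ?_)) hpal
    · rw [pointSpan_points_inter_points]
    · rw [← mul_assoc ((-1 : ℤ) ^ _), ← mul_pow, neg_one_mul, neg_neg, one_pow, one_mul]

/-- The inverse Kazhdan-Lusztig polynomial of the deletion of an element from a projective
geometry of rank `n` and order `q`. -/
noncomputable def deletionPoly (q n : ℕ) : ℤ[X] :=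
  Polynomial.C ((q : ℤ) ^ n.choose 2 - (q : ℤ) ^ (n - 1).choose 2) +
    Polynomial.C (qNumber (n - 1) q * (q : ℤ) ^ (n - 2).choose 2
      - (q : ℤ) ^ (n - 1).choose 2) * Polynomial.X

/-- Only rank two is delicate: there the linear coefficient is `[1] - 1 = 0`. -/
theorem natDegree_deletionPoly_lt {q n : ℕ} (hq : 1 < q) (hn : 2 ≤ n) :
    2 * (deletionPoly q n).natDegree < n := by
  rcases Nat.eq_or_lt_of_le hn with rfl | hn
  · have h : qNumber 1 q = 1 := by
      have hq1 : (q : ℤ) - 1 ≠ 0 := by simpa using pow_succ_sub_one_ne_zero hq 0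
      apply mul_right_cancel₀ hq1
      rw [qNumber_mul, pow_one, one_mul]
    have h' : deletionPoly q 2 = Polynomial.C ((q : ℤ) - 1) := by
      simp [deletionPoly, h]
    rw [h', Polynomial.natDegree_C]
    norm_num
  · have h : (deletionPoly q n).natDegree ≤ 1 := by
      unfold deletionPoly
      rw [add_comm]
      exact Polynomial.natDegree_linear_le
    omega

/-- This grouping makes each part sum to a palindromic polynomial over the subspaces through the
deleted point; `k` is the dimension modulo its line. -/
theorem deletionPoly_sub (q k : ℕ) :
    deletionPoly q (k + 1) - Polynomial.C ((q : ℤ) ^ (k + 1).choose 2) =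
      Polynomial.X * Polynomial.C (qNumber k q * (q : ℤ) ^ (k - 1).choose 2) -
        (1 + Polynomial.X) * Polynomial.C ((q : ℤ) ^ k.choose 2) := by
  rw [deletionPoly, Nat.add_sub_cancel, show k + 1 - 2 = k - 1 by omega, Polynomial.C_sub,
    Polynomial.C_sub]
  ring

open scoped Classical in
-- The sum runs over subspaces of the quotient by the line of `i`, of dimension `n + 1`; absorption
-- lowers the weighted part to dimension `n`.
theorem sum_subspaces_deletionPoly_sub [Fintype (Submodule K (Fin r → K))]
    {W : Submodule K (Fin r → K)} {i : ℙ K (Fin r → K)} (hi : i.rep ∈ W) {n : ℕ}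
    (hn : Module.finrank K W = n + 2) :
    ∑ U with Submodule.span K {i.rep} ≤ U ∧ U ≤ W,
      Polynomial.C ((Nat.card K : ℤ) ^ (n + 2 - Module.finrank K U).choose 2) *
        Polynomial.X ^ (n + 2 - Module.finrank K U) *
        (deletionPoly (Nat.card K) (Module.finrank K U) -
          Polynomial.C ((Nat.card K : ℤ) ^ (Module.finrank K U).choose 2)) =
      Polynomial.X * (Polynomial.C (qNumber (n + 1) (Nat.card K)) * subspacePoly (Nat.card K) n) -
        (1 + Polynomial.X) * subspacePoly (Nat.card K) (n + 1) := by
  rw [sum_submodule_interval (span_rep_le_iff.2 hi) fun d =>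
    Polynomial.C ((Nat.card K : ℤ) ^ (n + 2 - d).choose 2) * Polynomial.X ^ (n + 2 - d) *
      (deletionPoly (Nat.card K) d - Polynomial.C ((Nat.card K : ℤ) ^ d.choose 2)),
    ← sum_gaussBinom_mul_qNumber Finite.one_lt_card, subspacePoly, Finset.mul_sum, Finset.mul_sum,
    ← Finset.sum_sub_distrib, finrank_span_rep, hn]
  refine Finset.sum_congr rfl fun k _ => ?_
  rw [add_comm 1 k, deletionPoly_sub, show n + 2 - 1 = n + 1 by omega,
    show n + 2 - (k + 1) = n + 1 - k by omega, pow_add, pow_add,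
    ← eq_intCast Polynomial.C (gaussBinom _ _ _)]
  simp only [Polynomial.C_mul]
  ring

/-- The inverse Kazhdan-Lusztig polynomials of single element deletions of projective
geometries. -/
theorem inverseKL_PG_restrict_points_sdiff_singleton (i : ℙ K (Fin r → K))
    (W : Submodule K (Fin r → K)) (hi : i.rep ∈ W) (hW : 2 ≤ Module.finrank K W) :
    inverseKL (PG K r ↾ (points W \ {i})) = deletionPoly (Nat.card K) (Module.finrank K W) := by
  classical
  have := Fintype.ofFinite (Submodule K (Fin r → K))
  have hq : 1 < Nat.card K := Finite.one_lt_card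
  induction hn : Module.finrank K W using Nat.strong_induction_on generalizing W with
  | _ n ih =>
  obtain ⟨m, rfl⟩ := Nat.exists_eq_add_of_le' (hn ▸ hW)
  obtain ⟨L, hL⟩ : ∃ L, L = Submodule.span K {i.rep} := ⟨_, rfl⟩
  have hflat : ∀ U, pointSpan (points U ∩ (points W \ {i})) = U ↔ U ≤ W ∧ U ≠ L := fun U =>
    hL ▸ pointSpan_points_inter_sdiff_singleton
  have hLW : L ≤ W := hL ▸ span_rep_le_iff.2 hi
  have hL1 : Module.finrank K L = 1 := hL ▸ finrank_span_rep i
  have hWL : W ≠ L := fun h => by rw [h, hL1] at hn; omega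
  have hW0 : W ≠ ⊥ := fun h => by rw [h, finrank_bot] at hn; omega
  have hL0 : L ≠ ⊥ := fun h => by rw [h, finrank_bot] at hL1; omega
  have hspan : pointSpan (points W \ {i}) = W := pointSpan_points_sdiff_singleton (hL ▸ hWL)
  set q : ℕ := Nat.card K
  let g₀ : Submodule K (Fin r → K) → ℤ := fun U => (-1) ^ (m + 2 - Module.finrank K U) *
    (q : ℤ) ^ (m + 2 - Module.finrank K U).choose 2
  have hg₀ : ∀ T, T < W → ∑ U with T ≤ U ∧ U ≤ W, g₀ U = 0 := fun T hT => by
    have h := sum_interval_moebius hT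
    rwa [hn] at h
  -- With `L` gone from the lattice, its Möbius value is transferred to `⊥`, the only subspace
  -- strictly below it.
  let g : Submodule K (Fin r → K) → ℤ := fun U => g₀ U + if U = ⊥ then g₀ L else 0
  let h : Submodule K (Fin r → K) → ℤ[X] := fun U => if i.rep ∈ U
    then deletionPoly q (Module.finrank K U)
    else Polynomial.C ((q : ℤ) ^ (Module.finrank K U).choose 2)
  have key := inverseKL_PG_restrict_eq (points W \ {i}) (m + 2) (by rw [hspan, hn]) (by omega)
    g (by simp [hspan, g, g₀, hn, hW0]) ?_ h ?_
    (by
      simp only [hspan, h, if_pos hi, hn]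
      exact natDegree_deletionPoly_lt hq (by omega)) ?_
  · rw [key, hspan]
    simp only [h, if_pos hi, hn]
  · intro T hT hTW
    rw [hflat] at hT
    rw [hspan] at hTW
    simp only [hflat]
    have h0 := hg₀ T (lt_of_le_of_ne hT.1 hTW)
    rw [Finset.sum_add_distrib]
    by_cases hT0 : T = ⊥
    · subst hT0
      simp only [bot_le, and_true, true_and] at h0 ⊢
      rw [Finset.sum_ite_eq' _ (⊥ : Submodule K (Fin r → K)), if_pos (by simp [hL0.symm]),
        sum_le_and_ne_add hLW, h0]
    -- As `L` is an atom and `T` is neither `⊥` nor `L`, neither the missing term nor the correction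
    -- occurs above `T`.
    · rw [Finset.sum_eq_zero (f := fun U => if U = ⊥ then g₀ L else 0), add_zero, ← h0]
      · refine Finset.sum_congr (Finset.filter_congr fun U _ => ?_) fun _ _ => rfl
        refine ⟨fun hU => ⟨hU.2, hU.1.1⟩, fun hU => ⟨⟨hU.2, ?_⟩, hU.1⟩⟩
        intro hUL
        rcases (hL ▸ nonzero_span_atom i.rep i.rep_nonzero : IsAtom L).le_iff.1 (hUL ▸ hU.1) with h' | h'
        · exact hT0 h'
        · exact hT.2 h'
      · intro U hU
        rw [if_neg]
        rintro rfl
        exact hT0 (le_bot_iff.1 (Finset.mem_filter.1 hU).2.2)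
  · intro U hU hUW
    rw [hflat] at hU
    rw [hspan] at hUW
    rw [points_inter_sdiff_singleton hU.1]
    by_cases hiU : i.rep ∈ U
    · simp only [h, if_pos hiU]
      refine ih _ (hn ▸ Submodule.finrank_lt_finrank_of_lt hUW) U hiU ?_ rfl
      -- A subspace that contains `i` and differs from `L` has dimension at least two, as the
      -- induction requires.
      have := Submodule.finrank_lt_finrank_of_lt
        (lt_of_le_of_ne (hL ▸ span_rep_le_iff.2 hiU) hU.2.symm)
      rw [hL1] at this
      omega
    · simp only [h, if_neg hiU]
      rw [Set.sdiff_singleton_eq_self (show i ∉ points U from hiU), inverseKL_PG_restrict_points]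
  · simp only [hflat]
    let t : Submodule K (Fin r → K) → ℤ[X] := fun U =>
      Polynomial.C ((q : ℤ) ^ (m + 2 - Module.finrank K U).choose 2) *
        Polynomial.X ^ (m + 2 - Module.finrank K U)
    have hsgn : ∀ U : Submodule K (Fin r → K), Polynomial.C ((-1) ^ (m + 2 - Module.finrank K U) * g₀ U) *
        Polynomial.X ^ (m + 2 - Module.finrank K U) = t U := fun U => by
      simp only [t, g₀]
      rw [← mul_assoc ((-1 : ℤ) ^ _), ← mul_pow, neg_one_mul, neg_neg, one_pow, one_mul]
    have hpal : IsPalindromic (m + 2) (∑ U with U ≤ W, t U * h U) := by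
      -- Start from the sum for the full geometry and correct it on the subspaces through `i`.
      have e1 : ∑ U with U ≤ W, t U * h U = subspacePoly q (m + 2) +
          (Polynomial.X * (Polynomial.C (qNumber (m + 1) q) * subspacePoly q m) -
            (1 + Polynomial.X) * subspacePoly q (m + 1)) := by
        have h1 := sum_subspaces_eq_subspacePoly W
        have h2 := sum_subspaces_deletionPoly_sub hi hn
        rw [hn] at h1
        rw [← h1, ← h2, ← hL]
        have e2 : Finset.univ.filter (fun U => L ≤ U ∧ U ≤ W) =
            (Finset.univ.filter (· ≤ W)).filter (fun U => i.rep ∈ U) := by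
          rw [Finset.filter_filter]
          exact Finset.filter_congr fun U _ => by rw [hL, span_rep_le_iff, and_comm]
        rw [e2, Finset.sum_filter (fun U => i.rep ∈ U), ← Finset.sum_add_distrib]
        refine Finset.sum_congr rfl fun U _ => ?_
        simp only [h, t]
        split_ifs
        · ring
        · ring
      rw [e1]
      refine (isPalindromic_subspacePoly hq _).add (IsPalindromic.sub ?_ ?_)
      · have := isPalindromic_X.mul
          ((isPalindromic_C (qNumber (m + 1) q)).mul (isPalindromic_subspacePoly hq m))
        rwa [show 2 + (0 + m) = m + 2 by ring] at this
      · have := isPalindromic_one_add_X.mul (isPalindromic_subspacePoly hq (m + 1))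
        rwa [show 1 + (m + 1) = m + 2 by ring] at this
    refine Eq.mp (congrArg _ ?_) hpal
    -- The Möbius correction at `⊥` is exactly the absent term at `L`: since `h L = -X`, both are
    -- `-q ^ C(m+1,2) * X ^ (m+2)`.
    have hbot : ∀ U : Submodule K (Fin r → K), Polynomial.C ((-1) ^ (m + 2 - Module.finrank K U) * g U) *
        Polynomial.X ^ (m + 2 - Module.finrank K U) * h U =
          t U * h U + if U = ⊥ then t L * h L else 0 := by
      intro U
      by_cases hU : U = ⊥
      · subst hU
        have hiL : i.rep ∈ L := hL ▸ Submodule.mem_span_singleton_self _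
        have hib : i.rep ∉ (⊥ : Submodule K (Fin r → K)) := i.rep_nonzero
        have hd : deletionPoly q 1 = -Polynomial.X := by
          simp [deletionPoly, qNumber]
        simp only [g, if_true, mul_add, Polynomial.C_add, add_mul, hsgn]
        congr 1
        simp only [h, if_pos hiL, if_neg hib, t, g₀, hL1, finrank_bot, hd, Nat.sub_zero,
          show m + 2 - 1 = m + 1 by omega, Nat.choose_zero_succ, pow_zero, Polynomial.C_1, mul_one]
        rw [← mul_assoc ((-1 : ℤ) ^ _), ← pow_add,
          show m + 2 + (m + 1) = 2 * (m + 1) + 1 by ring, pow_succ, pow_mul]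
        simp
        ring
      · simp only [g, if_neg hU, add_zero, hsgn]
    rw [Finset.sum_congr rfl fun U _ => hbot U, Finset.sum_add_distrib,
      Finset.sum_ite_eq' _ (⊥ : Submodule K (Fin r → K)), if_pos (by simp [hL0.symm]),
      sum_le_and_ne_add hLW]

end Deletion

end InvKL

theorem proposition4p5 (K : Type*) [Field K] [Finite K] (q : ℕ) (hq : Nat.card K = q)
    (r : ℕ) (hr : 2 ≤ r) (i : ℙ K (Fin r → K)) :
    InvKL.inverseKL (InvKL.PG K r ＼ {i}) =
      Polynomial.C ((q : ℤ) ^ r.choose 2 - (q : ℤ) ^ (r - 1).choose 2) +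
        Polynomial.C (InvKL.qNumber (r - 1) q * (q : ℤ) ^ (r - 2).choose 2
          - (q : ℤ) ^ (r - 1).choose 2) * Polynomial.X := by
  have h := InvKL.inverseKL_PG_restrict_points_sdiff_singleton i ⊤ Submodule.mem_top
    (by rwa [finrank_top, Module.finrank_fin_fun])
  rw [finrank_top, Module.finrank_fin_fun, hq] at h
  -- By definition, deletion is restriction to the complement, and `points ⊤` is the whole ground
  -- set.
  exact h
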